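/- Let $G$ be a simplicial group with faces $d_i$ and degeneracies $s_i$. Let $NG_n=\bigcap_{i=0}^{n-1}\ker(d_i\colon G_n\to G_{n-1})$ (so $NG_0=G_0$), and let $D_n\le G_n$ be the subgroup generated by the degenerate elements $s_i(y)$, $y\in G_{n-1}$ (so $D_0=1$). Then for every $n\ge 0$ the subgroup $R_n=(NG_n\cap D_n)\,d_{n+1}(NG_{n+1}\cap D_{n+1})$ is normal in $G_n$, and the groups $$C_n(G)=\frac{NG_n}{(NG_n\cap D_n)\,d_{n+1}(NG_{n+1}\cap D_{n+1})}\qquad(n\ge 0)$$ form a crossed complex, in which $\partial_n\colon C_n(G)\to C_{n-1}(G)$ is well defined by $\partial_n\bar z=\overline{d_n(z)}$ for $z\in NG_n$, and $C_0(G)$ acts on $C_n(G)$, $n\ge 1$, by the well-defined action ${}^{\bar x}\bar y=\overline{s(x)\,y\,s(x)^{-1}}$ for $x\in G_0$, $y\in NG_n$, where $s=s_{n-1}\cdots s_1s_0$. Explicitly: 1. each $C_n(G)$, $n\ge1$, is a group on which $C_0(G)$ acts by automorphisms, and $\partial_1\colon C_1(G)\to C_0(G)$ is a crossed module, i.e.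 $\partial_1({}^{p}c)=p\,\partial_1(c)\,p^{-1}$ and ${}^{\partial_1(c)}c'=c\,c'c^{-1}$; 2. for $n\ge 2$ the group $C_n(G)$ is abelian and $\partial_1(C_1(G))$ acts trivially on it; 3. for $n\ge 2$ the homomorphism $\partial_n$ is $C_0(G)$-equivariant, and $\partial_{n-1}\partial_n$ is trivial. The same holds if $D_n$ is taken, for all $n$, to be the normal subgroup of $G_n$ generated by the degenerate elements. -/

import Mathlib

open CategoryTheory

universe u

namespace SimplicialGroup

/-! ### Crossed modules and crossed complexes of groups -/

/-- A homomorphism `d : M → P`, together with a left action of `P` on `M` by group automorphisms,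
is a crossed module. -/
structure IsCrossedModule {M P : Type*} [Group M] [Group P]
    (d : M →* P) (act : P →* MulAut M) : Prop where
  map_act (p : P) (m : M) : d (act p m) = p * d m * p⁻¹
  peiffer (m m' : M) : act (d m) m' = m * m' * m⁻¹

/-- The structure of a crossed complex on a sequence of groups `C 0, C 1, C 2, …`
(the reduced, i.e. one-vertex, case; the base group is in degree `0`). The group `C 0` acts on
the left, by automorphisms, on each `C (n + 1)`. -/
structure CrossedComplexStructure (C : ℕ → Type u) [∀ n, Group (C n)] where
  /-- the boundary maps -/
  d (n : ℕ) : C (n + 1) →* C n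
  /-- the actions of the base group -/
  act (n : ℕ) : C 0 →* MulAut (C (n + 1))
  /-- `C 1 → C 0` is a crossed module -/
  isCrossedModule : IsCrossedModule (d 0) (act 0)
  /-- the groups in degrees `≥ 2` are abelian -/
  comm (n : ℕ) (a b : C (n + 2)) : a * b = b * a
  /-- the image of `C 1` acts trivially in degrees `≥ 2` -/
  act_d (n : ℕ) (c : C 1) (a : C (n + 2)) : act (n + 1) (d 0 c) a = a
  /-- the boundary maps are equivariant -/
  d_act (n : ℕ) (g : C 0) (a : C (n + 2)) : d (n + 1) (act (n + 1) g a) = act n g (d (n + 1) a)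
  /-- composites of consecutive boundary maps are trivial -/
  d_d (n : ℕ) (a : C (n + 2)) : d n (d (n + 1) a) = 1

/-! ### The Moore complex of a simplicial group -/

variable (G : SimplicialObject GrpCat.{u})

/-- The group `G_n` of `n`-simplices of the simplicial group `G`. -/
abbrev level (n : ℕ) : GrpCat.{u} := G.obj (Opposite.op (SimplexCategory.mk n))

/-- The last face map `d_{n+1} : G_{n+1} → G_n`. -/
def lastFace (n : ℕ) : level G (n + 1) →* level G n := (G.δ (Fin.last (n + 1))).hom

/-- `NG_n`, the intersection of the kernels of `d_0, …, d_{n-1}` on `G_n`; so `NG_0 = G_0`. -/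
def moore : ∀ n : ℕ, Subgroup (level G n)
  | 0 => ⊤
  | n + 1 => ⨅ i : Fin (n + 1), (G.δ i.castSucc).hom.ker

instance moore_normal : ∀ n : ℕ, (moore G n).Normal
  | 0 => inferInstanceAs (⊤ : Subgroup (level G 0)).Normal
  | _ + 1 => Subgroup.normal_iInf_normal fun _ => inferInstance

variable {G} in
theorem lastFace_mem_moore {n : ℕ} {x : level G (n + 1)} (hx : x ∈ moore G (n + 1)) :
    lastFace G n x ∈ moore G n := by
  cases n with
  | zero => exact Subgroup.mem_top _
  | succ n =>
    simp only [moore, Subgroup.mem_iInf, MonoidHom.mem_ker] at hx ⊢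
    intro i
    have h := G.δ_comp_δ (Fin.le_last i.castSucc)
    have h' := congrArg (fun f => f.hom x) h
    simp only [GrpCat.hom_comp, MonoidHom.comp_apply, Fin.succ_last] at h'
    rw [lastFace, h', hx, map_one]

/-- The boundary `NG_{n+1} → NG_n` of the Moore complex: the restriction of the last face map. -/
def mooreBoundary (n : ℕ) : moore G (n + 1) →* moore G n :=
  ((lastFace G n).comp (moore G (n + 1)).subtype).codRestrict (moore G n)
    fun x => lastFace_mem_moore x.2

/-- The set of degenerate elements of `G_n`; there are none for `n = 0`. -/
def degenerate : ∀ n : ℕ, Set (level G n)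
  | 0 => ∅
  | n + 1 => {x | ∃ (i : Fin (n + 1)) (y : level G n), x = (G.σ i).hom y}

/-- The iterated degeneracy `s_{n-1} ⋯ s_1 s_0 : G_0 → G_n`. -/
def iteratedDegeneracy : ∀ n : ℕ, level G 0 →* level G n
  | 0 => MonoidHom.id _
  | n + 1 => (G.σ (Fin.last n)).hom.comp (iteratedDegeneracy n)

/-- Conjugation by `s_{n-1} ⋯ s_1 s_0 g` on `NG_n`. -/
def degConj (n : ℕ) (g : moore G 0) (y : moore G n) : moore G n :=
  ⟨iteratedDegeneracy G n g * y * (iteratedDegeneracy G n g)⁻¹,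
    (moore_normal G n).conj_mem _ y.2 _⟩

/-! ### The quotients `C_n(G)`

They are formed for a given family `D n` of subgroups of `G_n`. -/

variable (D : ∀ n : ℕ, Subgroup (level G n))

/-- The subgroup `(NG_n ∩ D_n) d_{n+1}(NG_{n+1} ∩ D_{n+1})` of `G_n`. -/
def relations (n : ℕ) : Subgroup (level G n) :=
  (moore G n ⊓ D n) ⊔ (moore G (n + 1) ⊓ D (n + 1)).map (lastFace G n)

/-- The join in `relations` is the set of products, as soon as `D_{n+1}` contains the image
of the last degeneracy. -/
theorem coe_relations (n : ℕ) (hD : ∀ y, (G.σ (Fin.last n)).hom y ∈ D (n + 1)) :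
    (relations G D n : Set (level G n)) =
      {z | ∃ a ∈ moore G n ⊓ D n, ∃ b ∈ moore G (n + 1) ⊓ D (n + 1),
        z = a * lastFace G n b} := by
  have hs (y : level G n) : lastFace G n ((G.σ (Fin.last n)).hom y) = y := by
    have h := congrArg (fun f => f.hom y) (G.δ_comp_σ_succ (i := Fin.last n))
    simpa [lastFace, Fin.succ_last] using h
  have hN : ((moore G (n + 1) ⊓ D (n + 1)).map (lastFace G n)).Normal := by
    refine ⟨?_⟩
    rintro _ ⟨b, hb, rfl⟩ g
    refine ⟨(G.σ (Fin.last n)).hom g * b * ((G.σ (Fin.last n)).hom g)⁻¹, ⟨?_, ?_⟩, ?_⟩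
    · exact (moore_normal G (n + 1)).conj_mem _ hb.1 _
    · exact (D (n + 1)).mul_mem ((D (n + 1)).mul_mem (hD g) hb.2) ((D (n + 1)).inv_mem (hD g))
    · simp only [map_mul, map_inv, hs]
  ext z
  rw [relations, SetLike.mem_coe, Subgroup.mem_sup_of_normal_right]
  constructor
  · rintro ⟨a, ha, _, ⟨b, hb, rfl⟩, rfl⟩
    exact ⟨a, ha, b, hb, rfl⟩
  · rintro ⟨a, ha, b, hb, rfl⟩
    exact ⟨a, ha, _, ⟨b, hb, rfl⟩, rfl⟩

/-- `C_n(G) = NG_n / ((NG_n ∩ D_n) d_{n+1}(NG_{n+1} ∩ D_{n+1}))`; a group as soon as the subgroup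
divided out is normal. -/
abbrev CQuot (n : ℕ) : Type u := moore G n ⧸ (relations G D n).subgroupOf (moore G n)

variable {G} in
/-- The class in `C_n(G)` of an element of `NG_n`. -/
def toC {n : ℕ} (x : moore G n) : CQuot G D n := QuotientGroup.mk x

end SimplicialGroup

/-! Only two facts about `D` matter: degenerate elements lie in it, and `D 0` is trivial. The engine
is `commutator_lastFace_mem`: if u, v ∈ D_{n+1} and each face except the last kills u or v, then [u,
v] ∈ NG_{n+1} ∩ D_{n+1}, so the commutator of their last faces is a relation. Everything else is a
choice of u and v.

Taking u = s_{n+1}x · (s_n x)⁻¹ and v = s_{n+1}y shows that x and s_n d_{n+1} x conjugate y ∈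
NG_{n+1} alike modulo relations (`peiffer_mem`). This gives normality of the relations and the
Peiffer identity in degree 1.

Next, an element of D_n killed by some d_k, k < n, centralises NG_n modulo relations
(`commutator_mem_of_face_eq_one`); here v is a degenerate filler of a horn. With `peiffer_mem` this
makes C_n abelian for n ≥ 2. For the trivial action of ∂C_1, the iterated degeneracy of d_1 c is
telescoped into quotients of successive degeneracies of c, each killed by one face. -/

namespace SimplicialGroup

/-! ### Simplicial identities with natural-number indices -/

section Identities

variable (G : SimplicialObject GrpCat.{u})

/-- The face map `d_i : G_{n+1} → G_n`, meaningful for `i ≤ n + 1`. -/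
def face (n i : ℕ) : level G (n + 1) →* level G n := (G.δ (Fin.ofNat (n + 2) i)).hom

/-- The degeneracy map `s_i : G_n → G_{n+1}`, meaningful for `i ≤ n`. -/
def degen (n i : ℕ) : level G n →* level G (n + 1) := (G.σ (Fin.ofNat (n + 1) i)).hom

variable {G}

theorem face_eq {n i : ℕ} (j : Fin (n + 2)) (h : (j : ℕ) = i) : face G n i = (G.δ j).hom := by
  subst h
  simp [face]

theorem degen_eq {n i : ℕ} (j : Fin (n + 1)) (h : (j : ℕ) = i) : degen G n i = (G.σ j).hom := by
  subst h
  simp [degen]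

theorem lastFace_eq (n : ℕ) : lastFace G n = face G n (n + 1) :=
  (face_eq (Fin.last (n + 1)) rfl).symm

theorem face_face {n i j : ℕ} (hij : i ≤ j) (hj : j ≤ n + 1) (x : level G (n + 2)) :
    face G n i (face G (n + 1) (j + 1) x) = face G n j (face G (n + 1) i x) := by
  let i' : Fin (n + 2) := ⟨i, by omega⟩
  let j' : Fin (n + 2) := ⟨j, by omega⟩
  have h := congrArg (fun f => f.hom x) (G.δ_comp_δ (i := i') (j := j') hij)
  rw [face_eq (i := i) i' rfl, face_eq (i := j + 1) j'.succ rfl, face_eq (i := j) j' rfl,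
    face_eq (i := i) i'.castSucc rfl]
  exact h

theorem face_degen_of_le {n i j : ℕ} (hij : i ≤ j) (hj : j ≤ n) (x : level G (n + 1)) :
    face G (n + 1) i (degen G (n + 1) (j + 1) x) = degen G n j (face G n i x) := by
  let i' : Fin (n + 2) := ⟨i, by omega⟩
  let j' : Fin (n + 1) := ⟨j, by omega⟩
  have h := congrArg (fun f => f.hom x) (G.δ_comp_σ_of_le (i := i') (j := j') hij)
  rw [face_eq (i := i) i'.castSucc rfl, degen_eq (i := j + 1) j'.succ rfl, face_eq (i := i) i' rfl, degen_eq (i := j) j' rfl]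
  exact h

theorem face_degen_of_gt {n i j : ℕ} (hij : j < i) (hi : i ≤ n + 1) (x : level G (n + 1)) :
    face G (n + 1) (i + 1) (degen G (n + 1) j x) = degen G n j (face G n i x) := by
  let i' : Fin (n + 2) := ⟨i, by omega⟩
  let j' : Fin (n + 1) := ⟨j, by omega⟩
  have h := congrArg (fun f => f.hom x) (G.δ_comp_σ_of_gt (i := i') (j := j') hij)
  rw [face_eq (i := i + 1) i'.succ rfl, degen_eq (i := j) j'.castSucc rfl, face_eq (i := i) i' rfl, degen_eq (i := j) j' rfl]
  exact h

theorem face_degen_self {n i : ℕ} (hi : i ≤ n) (x : level G n) :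
    face G n i (degen G n i x) = x := by
  let i' : Fin (n + 1) := ⟨i, by omega⟩
  have h := congrArg (fun f => f.hom x) (G.δ_comp_σ_self (i := i'))
  rw [face_eq (i := i) i'.castSucc rfl, degen_eq (i := i) i' rfl]
  exact h

theorem face_succ_degen {n i : ℕ} (hi : i ≤ n) (x : level G n) :
    face G n (i + 1) (degen G n i x) = x := by
  let i' : Fin (n + 1) := ⟨i, by omega⟩
  have h := congrArg (fun f => f.hom x) (G.δ_comp_σ_succ (i := i'))
  rw [face_eq (i := i + 1) i'.succ rfl, degen_eq (i := i) i' rfl]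
  exact h

theorem mem_moore_succ {n : ℕ} {x : level G (n + 1)} :
    x ∈ moore G (n + 1) ↔ ∀ i ≤ n, face G n i x = 1 := by
  simp only [moore, Subgroup.mem_iInf, MonoidHom.mem_ker]
  refine ⟨fun h i hi => ?_, fun h i => ?_⟩
  · rw [face_eq (i := i) (Fin.castSucc ⟨i, by omega⟩) rfl]
    exact h _
  · rw [← face_eq (i := i) i.castSucc rfl]
    exact h _ (Nat.lt_succ_iff.1 i.2)

end Identities

/-! ### Commutators lying in the relations -/

section Relations

open scoped commutatorElement

variable {G : SimplicialObject GrpCat.{u}} {D : ∀ n : ℕ, Subgroup (level G n)}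

theorem commutator_mem {H : Type*} [Group H] {K : Subgroup H} {a b : H} (ha : a ∈ K) (hb : b ∈ K) :
    ⁅a, b⁆ ∈ K :=
  K.mul_mem (K.mul_mem (K.mul_mem ha hb) (K.inv_mem ha)) (K.inv_mem hb)

theorem commutator_lastFace_mem {n : ℕ} {u v : level G (n + 1)} (hu : u ∈ D (n + 1))
    (hv : v ∈ D (n + 1)) (h : ∀ i ≤ n, face G n i u = 1 ∨ face G n i v = 1) :
    ⁅face G n (n + 1) u, face G n (n + 1) v⁆ ∈
      (moore G (n + 1) ⊓ D (n + 1)).map (lastFace G n) := by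
  refine ⟨⁅u, v⁆, ⟨mem_moore_succ.2 fun i hi => ?_, ?_⟩, ?_⟩
  · rw [map_commutatorElement]
    rcases h i hi with h | h <;> simp [h]
  · exact commutator_mem hu hv
  · rw [lastFace_eq, map_commutatorElement]

variable (hD : ∀ n i y, degen G n i y ∈ D (n + 1))
include hD

/-- The Peiffer commutators, in all positive degrees. -/
theorem peiffer_mem {n : ℕ} (x : level G (n + 1)) {y : level G (n + 1)}
    (hy : y ∈ moore G (n + 1)) :
    ⁅x * (degen G n n (face G n (n + 1) x))⁻¹, y⁆ ∈
      (moore G (n + 2) ⊓ D (n + 2)).map (lastFace G (n + 1)) := by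
  rw [mem_moore_succ] at hy
  -- The faces d_i with i ≤ n kill s_{n+1}y because y ∈ NG; on the remaining d_{n+1} the two
  -- degeneracies of x cancel.
  have h := commutator_lastFace_mem (D := D)
    (u := degen G (n + 1) (n + 1) x * (degen G (n + 1) n x)⁻¹) (v := degen G (n + 1) (n + 1) y)
    (mul_mem (hD _ _ _) (inv_mem (hD _ _ _))) (hD _ _ _) fun i hi => by
      rcases hi.lt_or_eq with h | rfl
      · right
        rw [face_degen_of_le (by omega) le_rfl, hy i (by omega), map_one]
      · left
        rw [map_mul, map_inv, face_degen_self le_rfl, face_succ_degen (by omega), mul_inv_cancel]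
  rwa [map_mul, map_inv, face_succ_degen le_rfl, face_succ_degen le_rfl,
    face_degen_of_gt (by omega) le_rfl] at h

theorem lastFace_map_normal (n : ℕ) :
    ((moore G (n + 1) ⊓ D (n + 1)).map (lastFace G n)).Normal := by
  refine ⟨?_⟩
  rintro _ ⟨b, hb, rfl⟩ g
  refine ⟨degen G n n g * b * (degen G n n g)⁻¹, ⟨(moore_normal G (n + 1)).conj_mem _ hb.1 _,
    mul_mem (mul_mem (hD _ _ _) hb.2) ((D _).inv_mem (hD _ _ _))⟩, ?_⟩
  rw [map_mul, map_mul, map_inv, lastFace_eq, face_succ_degen le_rfl]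

/-- `G_n = NG_n D_n`. -/
theorem exists_mul_mem_moore {n : ℕ} (x : level G (n + 1)) :
    ∃ t ∈ D (n + 1), x * t ∈ moore G (n + 1) := by
  suffices h : ∀ k ≤ n + 1, ∃ t ∈ D (n + 1), ∀ i < k, face G n i (x * t) = 1 by
    obtain ⟨t, ht, h⟩ := h (n + 1) le_rfl
    exact ⟨t, ht, mem_moore_succ.2 fun i hi => h i (by omega)⟩
  intro k
  induction k with
  | zero => exact fun _ => ⟨1, one_mem _, by simp⟩
  | succ k ih =>
    intro hk
    obtain ⟨t, ht, h⟩ := ih (by omega)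
    -- Dividing by s_k d_k kills the face d_k and keeps the lower faces, already killed, trivial.
    refine ⟨t * (degen G n k (face G n k (x * t)))⁻¹, mul_mem ht ((D _).inv_mem (hD _ _ _)),
      fun i hi => ?_⟩
    rw [← mul_assoc, map_mul _ (x * t), map_inv]
    rcases (Nat.lt_succ_iff.1 hi).lt_or_eq with h' | rfl
    · obtain ⟨k, rfl⟩ : ∃ k', k = k' + 1 := ⟨k - 1, by omega⟩
      obtain ⟨n, rfl⟩ : ∃ n', n = n' + 1 := ⟨n - 1, by omega⟩
      rw [face_degen_of_le (by omega) (by omega), face_face (by omega) (by omega), h i h']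
      simp
    · rw [face_degen_self (by omega), mul_inv_cancel]

theorem relations_normal (h0 : (D 0).Normal) (n : ℕ) : (relations G D n).Normal := by
  have hE := lastFace_map_normal hD n
  cases n with
  | zero => exact @Subgroup.sup_normal _ _ _ _ (@Subgroup.normal_inf_normal _ _ _ _
      (moore_normal G 0) h0) hE
  | succ n =>
    refine ⟨fun z hz g => ?_⟩
    rw [relations, Subgroup.mem_sup_of_normal_right] at hz
    obtain ⟨a, ha, b, hb, rfl⟩ := hz
    obtain ⟨t, ht, hm⟩ := exists_mul_mem_moore hD g
    have conj {a s : level G (n + 1)} (ha : a ∈ moore G (n + 1) ⊓ D (n + 1))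
        (hs : s ∈ D (n + 1)) : s * a * s⁻¹ ∈ moore G (n + 1) ⊓ D (n + 1) :=
      ⟨(moore_normal G _).conj_mem _ ha.1 _, mul_mem (mul_mem hs ha.2) ((D _).inv_mem hs)⟩
    -- The Peiffer commutator lets s ∈ D replace g t; conjugation by t⁻¹ and by s preserves NG ∩ D.
    set s := degen G n n (face G n (n + 1) (g * t)) with hs
    have h1 := conj (conj ha (inv_mem ht)) (s := s) (hD _ _ _)
    have h2 := peiffer_mem hD (g * t) h1.1
    rw [← hs] at h2
    have h3 : g * (a * b) * g⁻¹ = ⁅g * t * s⁻¹, s * (t⁻¹ * a * t⁻¹⁻¹) * s⁻¹⁆ *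
        (s * (t⁻¹ * a * t⁻¹⁻¹) * s⁻¹) * (g * b * g⁻¹) := by
      rw [commutatorElement_def]
      group
    rw [h3]
    exact mul_mem (mul_mem (Subgroup.mem_sup_right h2) (Subgroup.mem_sup_left h1))
      (Subgroup.mem_sup_right (hE.conj_mem _ hb _))

/-- Degenerate fillers of an almost trivial horn. -/
theorem exists_filler {n : ℕ} {y : level G (n + 1)} (hy : y ∈ moore G (n + 1)) {k : ℕ}
    (hk : k ≤ n + 1) :
    ∃ v ∈ D (n + 2), (∀ i ≤ n + 1, i ≠ k → face G (n + 1) i v = 1) ∧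
      y⁻¹ * face G (n + 1) (n + 2) v ∈ D (n + 1) := by
  rw [mem_moore_succ] at hy
  induction hk using Nat.decreasingInduction with
  | self =>
    refine ⟨degen G (n + 1) (n + 1) y, hD _ _ _, fun i hi hne => ?_, ?_⟩
    · rw [face_degen_of_le (by omega) le_rfl, hy i (by omega), map_one]
    · rw [face_succ_degen le_rfl, inv_mul_cancel]
      exact one_mem _
  | of_succ k hk ih =>
    obtain ⟨v, hv, h, hl⟩ := ih
    -- Dividing by s_k d_{k+1} v moves the possibly nontrivial face from k + 1 to k and changes the
    -- last face only by a degenerate element.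
    refine ⟨v * (degen G (n + 1) k (face G (n + 1) (k + 1) v))⁻¹,
      mul_mem hv ((D _).inv_mem (hD _ _ _)), fun i hi hne => ?_, ?_⟩
    · rw [map_mul, map_inv]
      rcases lt_trichotomy i (k + 1) with hlt | rfl | hgt
      · obtain ⟨k, rfl⟩ : ∃ k', k = k' + 1 := ⟨k - 1, by omega⟩
        rw [face_degen_of_le (by omega) (by omega), face_face (by omega) (by omega),
          h i hi (by omega)]
        simp
      · rw [face_succ_degen (by omega), mul_inv_cancel]
      · obtain ⟨i, rfl⟩ : ∃ i', i = i' + 1 := ⟨i - 1, by omega⟩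
        rw [face_degen_of_gt (by omega) (by omega), ← face_face (by omega) (by omega),
          h (i + 1) hi (by omega)]
        simp
    · rw [map_mul, map_inv, face_degen_of_gt (by omega) le_rfl, ← mul_assoc]
      exact mul_mem hl (inv_mem (hD _ _ _))

variable (h0 : (D 0).Normal)
include h0

/-- Elements of `D_n` with a trivial face `d_k`, `k < n`, centralise `NG_n` modulo the relations. -/
theorem commutator_mem_of_face_eq_one {n k : ℕ} (hk : k ≤ n) {u y : level G (n + 1)}
    (hu : u ∈ D (n + 1)) (huk : face G n k u = 1) (hy : y ∈ moore G (n + 1)) :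
    ⁅u, y⁆ ∈ relations G D (n + 1) := by
  obtain ⟨v, hv, h, hl⟩ := exists_filler hD hy (k := k) (by omega)
  have h1 := commutator_lastFace_mem (D := D) (hD (n + 1) (n + 1) u) hv fun i hi => by
    by_cases hik : i = k
    · subst hik
      left
      rw [face_degen_of_le hk le_rfl, huk, map_one]
    · exact Or.inr (h i hi hik)
  rw [face_succ_degen le_rfl] at h1
  set w := y⁻¹ * face G (n + 1) (n + 2) v with hw
  have hyw : face G (n + 1) (n + 1 + 1) v = y * w := by rw [hw, mul_inv_cancel_left]
  have h2 : ⁅u, w⁆ ∈ moore G (n + 1) ⊓ D (n + 1) := by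
    refine ⟨mem_moore_succ.2 fun i hi => ?_,
      commutator_mem hu hl⟩
    rw [map_commutatorElement]
    by_cases hik : i = k
    · rw [hik, huk, commutatorElement_one_left]
    · rw [hw, map_mul, map_inv, mem_moore_succ.1 hy i hi, face_face (by omega) le_rfl,
        h i (by omega) hik]
      simp
  have hR := relations_normal hD h0 (n + 1)
  have h3 : ⁅u, y⁆ = ⁅u, y * w⁆ * (y * ⁅u, w⁆⁻¹ * y⁻¹) := by
    simp only [commutatorElement_def]
    group
  rw [h3, ← hyw]
  exact mul_mem (Subgroup.mem_sup_right h1)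
    (hR.conj_mem _ (inv_mem (Subgroup.mem_sup_left h2)) _)

omit hD h0 in
theorem commutator_mul_mem (R : ∀ n, (relations G D n).Normal) {n : ℕ} {u v y : level G n}
    (hu : ⁅u, y⁆ ∈ relations G D n) (hv : ⁅v, y⁆ ∈ relations G D n) :
    ⁅u * v, y⁆ ∈ relations G D n := by
  have : ⁅u * v, y⁆ = u * ⁅v, y⁆ * u⁻¹ * ⁅u, y⁆ := by
    simp only [commutatorElement_def]
    group
  rw [this]
  exact mul_mem ((R n).conj_mem _ hv _) hu

/-- Modulo a Peiffer element, x is s_{n+1} d_{n+2} x, which lies in D and is killed by d_0. In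
degree 1 this fails: there d_0 s_0 d_1 x = d_1 x. -/
theorem commutator_moore_mem {n : ℕ} {x y : level G (n + 2)} (hx : x ∈ moore G (n + 2))
    (hy : y ∈ moore G (n + 2)) : ⁅x, y⁆ ∈ relations G D (n + 2) := by
  have h1 := Subgroup.mem_sup_right (S := moore G (n + 2) ⊓ D (n + 2)) (peiffer_mem hD x hy)
  have h2 := commutator_mem_of_face_eq_one hD h0 (k := 0) (Nat.zero_le _)
    (hD (n + 1) (n + 1) (face G (n + 1) (n + 2) x)) (by
      rw [face_degen_of_le (by omega) le_rfl, face_face (by omega) le_rfl,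
        mem_moore_succ.1 hx 0 (by omega), map_one, map_one]) hy
  simpa using commutator_mul_mem (relations_normal hD h0) h1 h2

end Relations

/-! ### Degeneracies of a 1-simplex and the action of ∂C_1 -/

section Step

open scoped commutatorElement

/-- The monotone map `[n] → [1]` sending `i` to `0` exactly when `i < k`. -/
def step (n k : ℕ) : SimplexCategory.mk n ⟶ SimplexCategory.mk 1 :=
  SimplexCategory.mkHom ⟨fun i => if (i : ℕ) < k then 0 else 1, fun i j hij => by
    have : (i : ℕ) ≤ j := hij
    dsimp only
    split_ifs
    · exact le_rfl
    · exact Fin.zero_le _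
    · omega
    · exact le_rfl⟩

theorem hom_ext_val {n m : ℕ} {f g : SimplexCategory.mk n ⟶ SimplexCategory.mk m}
    (h : ∀ i : Fin (n + 1), ((f i : Fin (m + 1)) : ℕ) = (g i : Fin (m + 1))) : f = g := by
  ext i : 3
  exact Fin.ext (h i)

theorem step_apply (n k : ℕ) (i : Fin (n + 1)) :
    (step n k i : Fin 2) = if (i : ℕ) < k then 0 else 1 := rfl

theorem δ_step {n k : ℕ} (i : Fin (n + 2)) :
    SimplexCategory.δ i ≫ step (n + 1) k = step n (if (i : ℕ) < k then k - 1 else k) := by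
  refine hom_ext_val fun j => ?_
  change ((step (n + 1) k (i.succAbove j) : Fin 2) : ℕ) = (step n _ j : Fin 2)
  rw [step_apply, step_apply]
  congr 1
  rcases lt_or_ge j.castSucc i with h | h
  · rw [Fin.succAbove_of_castSucc_lt _ _ h]
    have : (j : ℕ) < i := h
    congr 1
    simp only [Fin.val_castSucc, eq_iff_iff]
    split_ifs <;> omega
  · rw [Fin.succAbove_of_le_castSucc _ _ h]
    have : (i : ℕ) ≤ j := h
    congr 1
    simp only [Fin.val_succ, eq_iff_iff]
    split_ifs <;> omega

theorem σ_step {n k : ℕ} (i : Fin (n + 1)) :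
    SimplexCategory.σ i ≫ step n k = step (n + 1) (if (i : ℕ) < k then k + 1 else k) := by
  refine hom_ext_val fun j => ?_
  change ((step n k (i.predAbove j) : Fin 2) : ℕ) = (step (n + 1) _ j : Fin 2)
  rw [step_apply, step_apply]
  congr 2
  rcases le_or_gt j i.castSucc with h | h
  · rw [Fin.predAbove_of_le_castSucc _ _ h]
    have : (j : ℕ) ≤ i := h
    simp only [Fin.coe_castPred, eq_iff_iff]
    split_ifs <;> omega
  · rw [Fin.predAbove_of_castSucc_lt _ _ h]
    have : (i : ℕ) < j := h
    simp only [Fin.val_pred, eq_iff_iff]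
    split_ifs <;> omega

variable {G : SimplicialObject GrpCat.{u}} {D : ∀ n : ℕ, Subgroup (level G n)}

/-- The degeneration of a `1`-simplex along `step n k`. -/
def stepMap (n k : ℕ) : level G 1 →* level G n := (G.map (step n k).op).hom

theorem face_stepMap {n i k : ℕ} (hi : i ≤ n + 1) (c : level G 1) :
    face G n i (stepMap (n + 1) k c) = stepMap n (if i < k then k - 1 else k) c := by
  rw [face_eq (i := i) ⟨i, by omega⟩ rfl, stepMap, stepMap, ← δ_step ⟨i, by omega⟩, op_comp,
    G.map_comp]
  rfl

theorem degen_stepMap {n i k : ℕ} (hi : i ≤ n) (c : level G 1) :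
    degen G n i (stepMap n k c) = stepMap (n + 1) (if i < k then k + 1 else k) c := by
  rw [degen_eq (i := i) ⟨i, by omega⟩ rfl, stepMap, stepMap, ← σ_step ⟨i, by omega⟩, op_comp,
    G.map_comp]
  rfl

theorem stepMap_one_one (c : level G 1) : stepMap 1 1 c = c := by
  have : step 1 1 = 𝟙 _ := hom_ext_val fun i => by fin_cases i <;> rfl
  rw [stepMap, this, op_id, G.map_id]
  rfl

theorem stepMap_zero {c : level G 1} (hc : c ∈ moore G 1) (n : ℕ) : stepMap n 0 c = 1 := by
  induction n with
  | zero =>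
    have h := face_stepMap (n := 0) (i := 0) (k := 1) (by omega) c
    rw [stepMap_one_one, mem_moore_succ.1 hc 0 le_rfl] at h
    exact h.symm
  | succ n ih =>
    have h := degen_stepMap (n := n) (i := 0) (k := 0) (by omega) c
    rw [ih, map_one] at h
    exact h.symm

theorem iteratedDegeneracy_succ (n : ℕ) (g : level G 0) :
    iteratedDegeneracy G (n + 1) g = degen G n n (iteratedDegeneracy G n g) := by
  rw [degen_eq (i := n) (Fin.last n) rfl]
  rfl

theorem iteratedDegeneracy_lastFace (n : ℕ) (c : level G 1) :
    iteratedDegeneracy G n (lastFace G 0 c) = stepMap n (n + 1) c := by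
  induction n with
  | zero =>
    have h := face_stepMap (n := 0) (i := 1) (k := 1) le_rfl c
    rw [stepMap_one_one] at h
    rw [lastFace_eq]
    exact h
  | succ n ih => rw [iteratedDegeneracy_succ, ih, degen_stepMap le_rfl, if_pos (by omega)]

variable (hD : ∀ n i y, degen G n i y ∈ D (n + 1))
include hD

/-- A monotone map [n+2] → [1] identifies 0 with 1 (if k ≥ 2) or 1 with 2 (if k ≤ 1), so it factors
through a degeneracy. -/
theorem stepMap_mem (n k : ℕ) (c : level G 1) : stepMap (n + 2) k c ∈ D (n + 2) := by
  by_cases hk : 2 ≤ k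
  · have h := degen_stepMap (n := n + 1) (i := 0) (k := k - 1) (by omega) c
    rw [if_pos (by omega), Nat.sub_add_cancel (by omega)] at h
    exact h ▸ hD _ _ _
  · have h := degen_stepMap (n := n + 1) (i := 1) (k := k) (by omega) c
    rw [if_neg (by omega)] at h
    exact h ▸ hD _ _ _

/-- The boundaries of elements of `NG_1` centralise `NG_n`, `n ≥ 2`, modulo the relations. -/
theorem commutator_iteratedDegeneracy_mem (h0 : (D 0).Normal) {n : ℕ} {c : level G 1}
    (hc : c ∈ moore G 1) {y : level G (n + 2)} (hy : y ∈ moore G (n + 2)) :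
    ⁅iteratedDegeneracy G (n + 2) (lastFace G 0 c), y⁆ ∈ relations G D (n + 2) := by
  -- Telescoping starts at k = 0, where d_0 c = 1 makes the degeneracy trivial. The quotient of the
  -- terms k + 1 and k is killed by d_k.
  have key : ∀ k ≤ n + 2, ⁅stepMap (n + 2) k c, y⁆ ∈ relations G D (n + 2) := by
    intro k
    induction k with
    | zero => exact fun _ => by simp [stepMap_zero hc, one_mem]
    | succ k ih =>
      intro hk
      have h := commutator_mem_of_face_eq_one hD h0 (n := n + 1) (k := k) (by omega)
        (u := stepMap (n + 2) (k + 1) c * (stepMap (n + 2) k c)⁻¹)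
        (mul_mem (stepMap_mem hD _ _ _) ((D _).inv_mem (stepMap_mem hD _ _ _)))
        (by
          rw [map_mul, map_inv, face_stepMap (by omega), face_stepMap (by omega),
            if_pos (by omega), if_neg (by omega), Nat.add_sub_cancel, mul_inv_cancel]) hy
      simpa using commutator_mul_mem (relations_normal hD h0) h (ih (by omega))
  -- The final quotient, k = n + 2, is killed only by the last face, so it is lifted one degree up
  -- and paired with s_{n+2}y, as for Peiffer commutators.
  have h := commutator_lastFace_mem (D := D)
    (u := stepMap (n + 3) (n + 3) c * (stepMap (n + 3) (n + 2) c)⁻¹)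
    (v := degen G (n + 2) (n + 2) y)
    (mul_mem (stepMap_mem hD _ _ _) ((D _).inv_mem (stepMap_mem hD _ _ _))) (hD _ _ _)
    fun i hi => by
      rcases hi.lt_or_eq with h | rfl
      · right
        rw [face_degen_of_le (by omega) le_rfl, mem_moore_succ.1 hy i (by omega), map_one]
      · left
        rw [map_mul, map_inv, face_stepMap (by omega), face_stepMap (by omega),
          if_pos (by omega), if_neg (by omega), show n + 3 - 1 = n + 2 from rfl,
          mul_inv_cancel]
  rw [map_mul, map_inv, face_succ_degen le_rfl, face_stepMap le_rfl, face_stepMap le_rfl,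
    if_neg (by omega), if_neg (by omega)] at h
  rw [iteratedDegeneracy_lastFace]
  simpa using commutator_mul_mem (relations_normal hD h0) (Subgroup.mem_sup_right h)
    (key (n + 2) le_rfl)

end Step

/-! ### Boundaries and actions on the quotients -/

section CrossedComplex

open scoped commutatorElement

variable {G : SimplicialObject GrpCat.{u}} {D : ∀ n : ℕ, Subgroup (level G n)}

theorem toC_eq_of_div_mem [R : ∀ n, (relations G D n).Normal] {n : ℕ} {x y : moore G n}
    (h : (x : level G n) * (y : level G n)⁻¹ ∈ relations G D n) : toC D x = toC D y := by
  refine QuotientGroup.eq.2 (Subgroup.mem_subgroupOf.2 ?_)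
  have h' := (R n).conj_mem _ (inv_mem h) (x : level G n)⁻¹
  have e : ((x⁻¹ * y : moore G n) : level G n) =
      (x : level G n)⁻¹ * (x * (y : level G n)⁻¹)⁻¹ * (x : level G n)⁻¹⁻¹ := by
    push_cast
    group
  rw [e]
  exact h'

theorem lastFace_lastFace {n : ℕ} {x : level G (n + 2)} (hx : x ∈ moore G (n + 2)) :
    lastFace G n (lastFace G (n + 1) x) = 1 := by
  rw [lastFace_eq, lastFace_eq, face_face le_rfl le_rfl, mem_moore_succ.1 hx _ le_rfl, map_one]

theorem lastFace_mem_relations {n : ℕ} {x : level G (n + 1)}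
    (hx : x ∈ relations G D (n + 1)) : lastFace G n x ∈ relations G D n := by
  have : relations G D (n + 1) ≤ (relations G D n).comap (lastFace G n) := by
    refine sup_le (fun a ha => Subgroup.mem_sup_right ⟨a, ha, rfl⟩) ?_
    rintro _ ⟨b, hb, rfl⟩
    rw [Subgroup.mem_comap, lastFace_lastFace hb.1]
    exact one_mem _
  exact this hx

theorem lastFace_iteratedDegeneracy (n : ℕ) (g : level G 0) :
    lastFace G n (iteratedDegeneracy G (n + 1) g) = iteratedDegeneracy G n g := by
  rw [iteratedDegeneracy_succ, lastFace_eq, face_succ_degen le_rfl]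

section Quotient

variable [R : ∀ n, (relations G D n).Normal]

variable (D) in
/-- The boundary `C_{n+1}(G) → C_n(G)`. -/
def boundary (n : ℕ) : CQuot G D (n + 1) →* CQuot G D n :=
  QuotientGroup.map _ _ (mooreBoundary G n) fun _ hx =>
    Subgroup.mem_comap.2 <| Subgroup.mem_subgroupOf.2 (lastFace_mem_relations (Subgroup.mem_subgroupOf.1 hx))

variable (D) in
/-- The automorphism of `C_n(G)` induced by conjugation with an element of `G_n`. -/
def conjAut (n : ℕ) : level G n →* MulAut (CQuot G D n) where
  toFun g := QuotientGroup.congr _ _ (MulAut.conjNormal (H := moore G n) g) <| by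
    have key (h : level G n) : ((relations G D n).subgroupOf (moore G n)).map
        (MulAut.conjNormal (H := moore G n) h).toMonoidHom ≤
          (relations G D n).subgroupOf (moore G n) := by
      rintro _ ⟨x, hx, rfl⟩
      refine Subgroup.mem_subgroupOf.2 ?_
      change ((MulAut.conjNormal h x : moore G n) : level G n) ∈ _
      rw [MulAut.conjNormal_apply]
      exact (R n).conj_mem _ hx h
    refine le_antisymm (key g) fun x hx => ?_
    refine ⟨MulAut.conjNormal g⁻¹ x, key g⁻¹ ⟨x, hx, rfl⟩, ?_⟩
    change MulAut.conjNormal g (MulAut.conjNormal g⁻¹ x) = x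
    rw [← MulAut.mul_apply, ← map_mul, mul_inv_cancel, map_one, MulAut.one_apply]
  map_one' := by
    ext x
    obtain ⟨x, rfl⟩ := QuotientGroup.mk_surjective x
    change ((MulAut.conjNormal (1 : level G n) x : moore G n) : CQuot G D n) = _
    rw [map_one]
    rfl
  map_mul' g h := by
    ext x
    obtain ⟨x, rfl⟩ := QuotientGroup.mk_surjective x
    change ((MulAut.conjNormal (g * h) x : moore G n) : CQuot G D n) = _
    rw [map_mul]
    rfl

theorem conjAut_toC {n : ℕ} (g : level G n) (y : moore G n) :
    conjAut D n g (toC D y) =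
      toC D ⟨g * (y : level G n) * g⁻¹, (moore_normal G n).conj_mem _ y.2 _⟩ := by
  change toC D (MulAut.conjNormal g y) = _
  congr 1

theorem conjAut_eq_one {n : ℕ} {g : level G n}
    (h : ∀ y ∈ moore G n, ⁅g, y⁆ ∈ relations G D n) : conjAut D n g = 1 := by
  ext x
  obtain ⟨y, rfl⟩ := QuotientGroup.mk_surjective x
  exact (conjAut_toC g y).trans (toC_eq_of_div_mem (h y y.2))

theorem conjAut_degen_face (hD : ∀ n i y, degen G n i y ∈ D (n + 1)) {n : ℕ}
    (x : level G (n + 1)) :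
    conjAut D (n + 1) (degen G n n (face G n (n + 1) x)) = conjAut D (n + 1) x := by
  have h : conjAut D (n + 1) (x * (degen G n n (face G n (n + 1) x))⁻¹) = 1 :=
    conjAut_eq_one fun y hy => Subgroup.mem_sup_right (peiffer_mem hD x hy)
  rw [map_mul, map_inv, mul_inv_eq_one] at h
  exact h.symm

theorem conjAut_iteratedDegeneracy_relations (hD : ∀ n i y, degen G n i y ∈ D (n + 1))
    (h0 : D 0 = ⊥) (n : ℕ) {g : level G 0} (hg : g ∈ relations G D 0) :
    conjAut D (n + 1) (iteratedDegeneracy G (n + 1) g) = 1 := by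
  rw [relations, h0, inf_bot_eq, bot_sup_eq] at hg
  obtain ⟨c, hc, rfl⟩ := hg
  have h0' : (D 0).Normal := h0 ▸ inferInstance
  cases n with
  | zero =>
    -- In degree 1, s_0 d_1 c acts as c does, and c ∈ NG_1 ∩ D_1 is itself a relation.
    rw [iteratedDegeneracy_succ, lastFace_eq]
    refine (conjAut_degen_face hD c).trans (conjAut_eq_one fun y _ => ?_)
    have hcR : c ∈ relations G D 1 := Subgroup.mem_sup_left hc
    rw [commutatorElement_def, mul_assoc, mul_assoc, ← mul_assoc y]
    exact mul_mem hcR ((R 1).conj_mem _ (inv_mem hcR) y)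
  | succ n =>
    exact conjAut_eq_one fun y hy => commutator_iteratedDegeneracy_mem hD h0' hc.1 hy

variable (D) in
/-- The action of `C_0(G)` on `C_{n+1}(G)`. -/
def action (hD : ∀ n i y, degen G n i y ∈ D (n + 1)) (h0 : D 0 = ⊥) (n : ℕ) :
    CQuot G D 0 →* MulAut (CQuot G D (n + 1)) :=
  QuotientGroup.lift _
    (((conjAut D (n + 1)).comp (iteratedDegeneracy G (n + 1))).comp (moore G 0).subtype)
    fun _ hg => conjAut_iteratedDegeneracy_relations hD h0 n hg

theorem boundary_toC (n : ℕ) (x : moore G (n + 1)) :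
    boundary D n (toC D x) = toC D (mooreBoundary G n x) := rfl

theorem action_toC (hD : ∀ n i y, degen G n i y ∈ D (n + 1)) (h0 : D 0 = ⊥) (n : ℕ)
    (g : moore G 0) (y : moore G (n + 1)) :
    action D hD h0 n (toC D g) (toC D y) = toC D (degConj G (n + 1) g y) :=
  conjAut_toC _ y

theorem toC_mul {n : ℕ} (x y : moore G n) : toC D (x * y) = toC D x * toC D y := rfl

theorem toC_inv {n : ℕ} (x : moore G n) : toC D x⁻¹ = (toC D x)⁻¹ := rfl

omit R in
theorem toC_surjective (n : ℕ) : Function.Surjective (toC D (n := n)) :=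
  QuotientGroup.mk_surjective

/-- The crossed complex `C(G)`. -/
def crossedComplexStructure (hD : ∀ n i y, degen G n i y ∈ D (n + 1)) (h0 : D 0 = ⊥) :
    CrossedComplexStructure (fun n => CQuot G D n) where
  d := boundary D
  act := action D hD h0
  isCrossedModule := by
    refine ⟨fun p m => ?_, fun m m' => ?_⟩
    · obtain ⟨p, rfl⟩ := toC_surjective _ p
      obtain ⟨m, rfl⟩ := toC_surjective _ m
      rw [action_toC, boundary_toC, boundary_toC, ← toC_inv, ← toC_mul, ← toC_mul]
      congr 1
      refine Subtype.ext ?_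
      change lastFace G 0 (_ * _ * _⁻¹) = _ * lastFace G 0 _ * _⁻¹
      rw [map_mul, map_mul, map_inv, lastFace_iteratedDegeneracy]
      rfl
    · obtain ⟨m, rfl⟩ := toC_surjective _ m
      obtain ⟨m', rfl⟩ := toC_surjective _ m'
      change conjAut D 1 (iteratedDegeneracy G 1 (lastFace G 0 m)) (toC D m') = _
      rw [iteratedDegeneracy_succ, lastFace_eq]
      exact (congrArg (· (toC D m')) (conjAut_degen_face hD m.1)).trans (conjAut_toC _ m')
  comm n a b := by
    obtain ⟨a, rfl⟩ := toC_surjective _ a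
    obtain ⟨b, rfl⟩ := toC_surjective _ b
    rw [← toC_mul, ← toC_mul]
    refine toC_eq_of_div_mem ?_
    have h := commutator_moore_mem hD (h0 ▸ inferInstance) a.2 b.2
    rw [commutatorElement_def] at h
    simpa [mul_assoc] using h
  act_d n c a := by
    obtain ⟨c, rfl⟩ := toC_surjective _ c
    obtain ⟨a, rfl⟩ := toC_surjective _ a
    rw [boundary_toC, action_toC]
    exact toC_eq_of_div_mem
      (commutator_iteratedDegeneracy_mem hD (h0 ▸ inferInstance) c.2 a.2)
  d_act n g a := by
    obtain ⟨g, rfl⟩ := toC_surjective _ g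
    obtain ⟨a, rfl⟩ := toC_surjective _ a
    rw [action_toC, boundary_toC, boundary_toC, action_toC]
    congr 1
    refine Subtype.ext ?_
    change lastFace G (n + 1) (_ * _ * _⁻¹) = _ * lastFace G (n + 1) _ * _⁻¹
    rw [map_mul, map_mul, map_inv, lastFace_iteratedDegeneracy]
    rfl
  d_d n a := by
    obtain ⟨a, rfl⟩ := toC_surjective _ a
    rw [boundary_toC, boundary_toC]
    exact congrArg (toC D) (Subtype.ext (lastFace_lastFace a.2))

end Quotient

end CrossedComplex

end SimplicialGroup

open SimplicialGroup in
theorem mainTheorem4 (G : SimplicialObject GrpCat.{u}) (D : ∀ n : ℕ, Subgroup (level G n))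
    (hD : (∀ n, D n = Subgroup.closure (degenerate G n)) ∨
      (∀ n, D n = Subgroup.normalClosure (degenerate G n))) :
    ∃ _ : ∀ n, (relations G D n).Normal,
      ∃ K : CrossedComplexStructure (fun n => CQuot G D n),
        (∀ (n : ℕ) (x : moore G (n + 1)), K.d n (toC D x) = toC D (mooreBoundary G n x)) ∧
        (∀ (n : ℕ) (g : moore G 0) (y : moore G (n + 1)),
          K.act n (toC D g) (toC D y) = toC D (degConj G (n + 1) g y)) := by
  have hσ : ∀ n i y, degen G n i y ∈ D (n + 1) := fun n i y => by
    have hy : degen G n i y ∈ degenerate G (n + 1) := ⟨_, y, rfl⟩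
    rcases hD with h | h
    · exact h _ ▸ Subgroup.subset_closure hy
    · exact h _ ▸ Subgroup.subset_normalClosure hy
  have h0 : D 0 = ⊥ := by
    rcases hD with h | h
    · exact (h 0).trans Subgroup.closure_empty
    · exact (h 0).trans Subgroup.normalClosure_empty
  have R := relations_normal hσ (h0 ▸ inferInstance)
  exact ⟨R, crossedComplexStructure hσ h0, fun _ _ => rfl, action_toC hσ h0⟩
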